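/- Let $X_1,X_2,X_3$ be independent random variables, each exponentially distributed with density $e^{-x}$, $x>0$. Let $\bar X=\frac13\sum_{i=1}^3 X_i$, let $S^2=\frac13\sum_{i=1}^3 (X_i-\bar X)^2$ be the biased sample variance, with $S=\sqrt{S^2}$, let $\hat\alpha=\bar X^2/S^2$ and let $T=\bar X/S$. Then $T=\sqrt{\hat\alpha}$ almost surely, and the cumulative distribution function $F(t)=P(T\le t)$ of $T$ is given by $$ F(t)=\begin{cases} 1-\dfrac{2\pi}{3\sqrt3\,t^2}, & t\ge\sqrt2,\\[2ex] -\dfrac{\sqrt{2-t^2}}{\sqrt3\,t}+\dfrac{\pi}{3\sqrt3\,t^2}-\dfrac{2\arcsin\left(t/\sqrt2\right)}{\sqrt3\,t^2}+1, & \dfrac{\sqrt2}{2}\le t\le\sqrt2,\\[2ex] 0, & t<\dfrac{\sqrt2}{2}. \end{cases} $$ -/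

import Mathlib

open MeasureTheory ProbabilityTheory

noncomputable section

/-- The sample mean of `x₁, …, xₙ`. -/
def sampleMean {n : ℕ} (x : Fin n → ℝ) : ℝ :=
  (∑ i, x i) / n

/-- The biased sample variance of `x₁, …, xₙ` (normalised by `n`). -/
def sampleVar {n : ℕ} (x : Fin n → ℝ) : ℝ :=
  (∑ i, (x i - sampleMean x) ^ 2) / n

/-- The biased sample standard deviation. -/
def sampleSD {n : ℕ} (x : Fin n → ℝ) : ℝ :=
  Real.sqrt (sampleVar x)

/-- The moment estimator of the shape parameter of the gamma distribution. -/
def shapeEstimator {n : ℕ} (x : Fin n → ℝ) : ℝ :=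
  sampleMean x ^ 2 / sampleVar x

/-- The statistic `T`, the ratio of the sample mean to the biased sample standard deviation. -/
def ratioStat {n : ℕ} (x : Fin n → ℝ) : ℝ :=
  sampleMean x / sampleSD x

end

/-! `T` is invariant under positive scaling, so `T > t` is a cone. The joint density `exp (-(x + y +
z))` on the positive octant is constant on each plane of fixed sum `s`, where the cone cuts out `s`
times its slice `K` of the simplex. Hence its probability is `∫ exp (-s) * s ^ 2` times the area of
`K`, that is, twice that area (`expMeasure_prod_prod_apply_cone`).

On the simplex the mean is `1 / 3`, so `T > t` bounds the variance: it describes a disc about the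
centroid, with `r = √2 / (3 * t)` (`lt_ratioStat_iff`). For `r ≤ 1 / 3` the disc lies within the
inscribed circle; for `1 / 3 ≤ r ≤ 2 / 3` the sides cut off three disjoint segments of equal area
(`volume_planeDisc_inter_planeSimplex`). At `r = 2 / 3`, the circumscribed circle, the simplex is
exhausted. -/

theorem hasDerivAt_circle {r a : ℝ} (hr : 0 < r) (h1 : -r < a) (h2 : a < r) :
    HasDerivAt (fun a => (a * Real.sqrt (r ^ 2 - a ^ 2) + r ^ 2 * Real.arcsin (a / r)) / 2)
      (Real.sqrt (r ^ 2 - a ^ 2)) a := by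
  have hpos : 0 < r ^ 2 - a ^ 2 := by nlinarith
  have hs : 0 < Real.sqrt (r ^ 2 - a ^ 2) := Real.sqrt_pos.2 hpos
  have hss : Real.sqrt (r ^ 2 - a ^ 2) ^ 2 = r ^ 2 - a ^ 2 := Real.sq_sqrt hpos.le
  have e1 : HasDerivAt (fun a : ℝ => r ^ 2 - a ^ 2) (-(2 * a)) a := by
    simpa using ((hasDerivAt_pow 2 a).const_sub (r ^ 2))
  have e2 := (hasDerivAt_id a).mul (e1.sqrt hpos.ne')
  have e3 : HasDerivAt (fun a : ℝ => Real.arcsin (a / r))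
      (1 / Real.sqrt (1 - (a / r) ^ 2) * (1 / r)) a := by
    have := (Real.hasDerivAt_arcsin (x := a / r)
      (by rw [ne_eq, div_eq_iff hr.ne']; linarith)
      (by rw [ne_eq, div_eq_iff hr.ne']; linarith)).comp a ((hasDerivAt_id a).div_const r)
    exact this
  have e4 : Real.sqrt (1 - (a / r) ^ 2) = Real.sqrt (r ^ 2 - a ^ 2) / r := by
    rw [show 1 - (a / r) ^ 2 = (r ^ 2 - a ^ 2) / r ^ 2 by field_simp,
      Real.sqrt_div hpos.le, Real.sqrt_sq hr.le]
  rw [e4] at e3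
  refine ((e2.add (e3.const_mul (r ^ 2))).div_const 2).congr_deriv ?_
  simp only [id]
  field_simp
  linear_combination -hss

/-- The primitive is only needed to be continuous at the endpoints, so `b = r` is allowed; this
gives the full disc. -/
theorem integral_sqrt_sq_sub_sq {r b : ℝ} (hr : 0 < r) (h1 : -r ≤ b) (h2 : b ≤ r) :
    ∫ a in (-r)..b, Real.sqrt (r ^ 2 - a ^ 2)
      = (b * Real.sqrt (r ^ 2 - b ^ 2) + r ^ 2 * (Real.arcsin (b / r) + Real.pi / 2)) / 2 := by
  rw [intervalIntegral.integral_eq_sub_of_hasDerivAt_of_le h1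
    (f := fun a => (a * Real.sqrt (r ^ 2 - a ^ 2) + r ^ 2 * Real.arcsin (a / r)) / 2)]
  · simp [neg_div, div_self hr.ne']; ring
  · fun_prop
  · intro x hx
    exact hasDerivAt_circle hr hx.1 (hx.2.trans_le h2)
  · exact (by fun_prop : Continuous fun a : ℝ => Real.sqrt (r ^ 2 - a ^ 2)).intervalIntegrable _ _

/-! ### Area of the disc inside the simplex -/

/-- The points of the plane `x + y + z = 1`, in the coordinates `(x, y)`, at distance less than
`r * √(3 / 2)` from `(1 / 3, 1 / 3, 1 / 3)`. -/
def planeDisc (r : ℝ) : Set (ℝ × ℝ) :=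
  {p | p.1 ^ 2 + p.2 ^ 2 + (1 - p.1 - p.2) ^ 2 - 1 / 3 < 3 / 2 * r ^ 2}

/-- Completing the square in `y` shows that the section over `x` is an interval centred at `(1 - x)
/ 2`, and that `r` is the half-width of the disc in the `x` direction. -/
theorem volume_planeDisc_inter {r m : ℝ} (hr : 0 < r) (h1 : 1 / 3 - r ≤ m) (h2 : m ≤ 1 / 3 + r) :
    volume (planeDisc r ∩ {p | p.1 < m}) = ENNReal.ofReal (Real.sqrt 3 *
      (((m - 1 / 3) * Real.sqrt (r ^ 2 - (m - 1 / 3) ^ 2)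
        + r ^ 2 * (Real.arcsin ((m - 1 / 3) / r) + Real.pi / 2)) / 2)) := by
  set h : ℝ → ℝ := fun x => Real.sqrt 3 / 2 * Real.sqrt (r ^ 2 - (x - 1 / 3) ^ 2) with hh
  have hcont : Continuous h := by fun_prop
  have heq : planeDisc r ∩ {p | p.1 < m} =
      regionBetween (fun x => (1 - x) / 2 - h x) (fun x => (1 - x) / 2 + h x)
        (Set.Ioo (1 / 3 - r) m) := by
    ext ⟨x, y⟩
    simp only [planeDisc, regionBetween, Set.mem_inter_iff, Set.mem_ofPred_eq, Set.mem_Ioo]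
    have key : x ^ 2 + y ^ 2 + (1 - x - y) ^ 2 - 1 / 3
        = 3 / 2 * (x - 1 / 3) ^ 2 + 2 * (y - (1 - x) / 2) ^ 2 := by ring
    have key2 : (1 - x) / 2 - h x < y ∧ y < (1 - x) / 2 + h x ↔ |y - (1 - x) / 2| < h x := by
      rw [abs_lt]; constructor <;> rintro ⟨_, _⟩ <;> constructor <;> linarith
    have key3 : h x = Real.sqrt (3 / 4 * (r ^ 2 - (x - 1 / 3) ^ 2)) := by
      rw [hh, Real.sqrt_mul (by norm_num), Real.sqrt_div (by norm_num),
        show (4 : ℝ) = 2 ^ 2 by norm_num, Real.sqrt_sq (by norm_num)]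
    rw [key, key2, key3, Real.lt_sqrt (abs_nonneg _), sq_abs]
    constructor
    · rintro ⟨a, b⟩
      refine ⟨⟨?_, b⟩, by linarith⟩
      have : |x - 1 / 3| < r := abs_lt_of_sq_lt_sq (by nlinarith [sq_nonneg (y - (1 - x) / 2)]) hr.le
      linarith [(abs_lt.1 this).1]
    · rintro ⟨⟨a, b⟩, c⟩
      exact ⟨by linarith, b⟩
  rw [heq, Measure.volume_eq_prod, volume_regionBetween_eq_integral
    ((by fun_prop : Continuous fun x => (1 - x) / 2 - h x).integrableOn_Icc.mono_set
      Set.Ioo_subset_Icc_self)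
    ((by fun_prop : Continuous fun x => (1 - x) / 2 + h x).integrableOn_Icc.mono_set
      Set.Ioo_subset_Icc_self) measurableSet_Ioo
    (fun x _ => by have : 0 ≤ h x := by positivity
                   linarith)]
  congr 1
  rw [← integral_sqrt_sq_sub_sq hr (by linarith) (by linarith),
    ← intervalIntegral.integral_const_mul,
    ← integral_Ioc_eq_integral_Ioo, ← intervalIntegral.integral_of_le h1]
  have := intervalIntegral.integral_comp_sub_right (a := 1 / 3 - r) (b := m)
    (fun a => Real.sqrt 3 * Real.sqrt (r ^ 2 - a ^ 2)) (1 / 3)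
  rw [show 1 / 3 - r - 1 / 3 = -r by ring] at this
  rw [← this]
  congr 1
  ext x
  simp only [Pi.sub_apply, hh]
  ring

/-- The simplex `x, y, z ≥ 0`, `x + y + z = 1`, in the coordinates `(x, y)`. -/
def planeSimplex : Set (ℝ × ℝ) :=
  {p | 0 ≤ p.1 ∧ 0 ≤ p.2 ∧ 0 ≤ 1 - p.1 - p.2}

theorem measurableSet_planeDisc (r : ℝ) : MeasurableSet (planeDisc r) :=
  (isOpen_lt (by fun_prop) (by fun_prop)).measurableSet

theorem measurableSet_planeSimplex : MeasurableSet planeSimplex := by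
  unfold planeSimplex
  measurability

theorem volume_planeDisc_inter_snd_neg (r : ℝ) :
    volume (planeDisc r ∩ {p | p.2 < 0}) = volume (planeDisc r ∩ {p | p.1 < 0}) := by
  have hm : MeasurableSet (planeDisc r ∩ {p | p.1 < 0}) :=
    (measurableSet_planeDisc r).inter (by measurability)
  rw [Measure.volume_eq_prod, ← (Measure.measurePreserving_swap (μ := (volume : Measure ℝ))
    (ν := (volume : Measure ℝ))).measure_preimage hm.nullMeasurableSet]
  congr 1
  ext ⟨x, y⟩
  simp only [planeDisc, Set.mem_inter_iff, Set.mem_preimage, Set.mem_ofPred_eq, Prod.swap_prod_mk]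
  rw [show x ^ 2 + y ^ 2 + (1 - x - y) ^ 2 = y ^ 2 + x ^ 2 + (1 - y - x) ^ 2 by ring]

theorem volume_planeDisc_inter_third_neg (r : ℝ) :
    volume (planeDisc r ∩ {p | 1 - p.1 - p.2 < 0}) = volume (planeDisc r ∩ {p | p.2 < 0}) := by
  have hm : MeasurableSet (planeDisc r ∩ {p | p.2 < 0}) :=
    (measurableSet_planeDisc r).inter (by measurability)
  -- This shear exchanges the second and third barycentric coordinates.
  have hp : MeasurePreserving (fun p : ℝ × ℝ => (p.1, 1 - p.1 - p.2))
      ((volume : Measure ℝ).prod volume) ((volume : Measure ℝ).prod volume) :=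
    (MeasurePreserving.id volume).skew_product (g := fun x y : ℝ => 1 - x - y)
      (by fun_prop) (ae_of_all _ fun x =>
        (Measure.measurePreserving_sub_left (volume : Measure ℝ) (1 - x)).map_eq)
  rw [Measure.volume_eq_prod, ← hp.measure_preimage hm.nullMeasurableSet]
  congr 1
  ext ⟨x, y⟩
  simp only [planeDisc, Set.mem_inter_iff, Set.mem_preimage, Set.mem_ofPred_eq]
  rw [show x ^ 2 + y ^ 2 + (1 - x - y) ^ 2 = x ^ 2 + (1 - x - y) ^ 2 + (1 - x - (1 - x - y)) ^ 2
    by ring]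

theorem volume_planeDisc {r : ℝ} (hr : 0 < r) :
    volume (planeDisc r) = ENNReal.ofReal (Real.sqrt 3 * Real.pi * r ^ 2 / 2) := by
  have h := volume_planeDisc_inter hr (m := 1 / 3 + r) (by linarith) le_rfl
  rw [Set.inter_eq_left.2] at h
  · rw [h, add_sub_cancel_left, div_self hr.ne', Real.arcsin_one]
    congr 1
    simp
    ring
  · rintro ⟨x, y⟩ hp
    simp only [planeDisc, Set.mem_ofPred_eq] at hp ⊢
    by_contra! hc
    nlinarith [sq_nonneg (y - (1 - x) / 2)]

/-- The three segments are disjoint: with two negative coordinates the third exceeds `1`, so the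
squared distance to the centroid exceeds `2 / 3`, which is `3 / 2 * r ^ 2` at `r = 2 / 3`. -/
theorem volume_planeDisc_inter_planeSimplex {r : ℝ} (hr : 0 < r) (hr' : r ≤ 2 / 3) :
    volume.real (planeDisc r ∩ planeSimplex)
      = Real.sqrt 3 * Real.pi * r ^ 2 / 2 - 3 * volume.real (planeDisc r ∩ {p | p.1 < 0}) := by
  have hD := measurableSet_planeDisc r
  have hfin : volume (planeDisc r) ≠ ⊤ := by rw [volume_planeDisc hr]; exact ENNReal.ofReal_ne_top
  have hfin' : ∀ s, volume (planeDisc r ∩ s) ≠ ⊤ := fun s =>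
    measure_ne_top_of_subset Set.inter_subset_left hfin
  have h1 : MeasurableSet (planeDisc r ∩ {p | p.1 < 0}) := hD.inter (by measurability)
  have h2 : MeasurableSet (planeDisc r ∩ {p | p.2 < 0}) := hD.inter (by measurability)
  have h3 : MeasurableSet (planeDisc r ∩ {p | 1 - p.1 - p.2 < 0}) := hD.inter (by measurability)
  have hsplit := measureReal_inter_add_sdiff (μ := volume) (s := planeDisc r)
    measurableSet_planeSimplex (h := hfin)
  have hdiff : planeDisc r \ planeSimplex = (planeDisc r ∩ {p | p.1 < 0}) ∪
      ((planeDisc r ∩ {p | p.2 < 0}) ∪ (planeDisc r ∩ {p | 1 - p.1 - p.2 < 0})) := by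
    ext p
    simp only [planeSimplex, Set.mem_sdiff, Set.mem_union, Set.mem_inter_iff, Set.mem_ofPred_eq]
    rw [← not_le, ← not_le, ← not_le]
    tauto
  have hd23 : Disjoint (planeDisc r ∩ {p | p.2 < 0}) (planeDisc r ∩ {p | 1 - p.1 - p.2 < 0}) := by
    rw [Set.disjoint_left]
    rintro ⟨x, y⟩ ⟨ha, hb⟩ ⟨-, hc⟩
    simp only [planeDisc, Set.mem_ofPred_eq] at ha hb hc
    nlinarith [sq_nonneg y, sq_nonneg (1 - x - y)]
  have hd1 : Disjoint (planeDisc r ∩ {p | p.1 < 0}) ((planeDisc r ∩ {p | p.2 < 0}) ∪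
      (planeDisc r ∩ {p | 1 - p.1 - p.2 < 0})) := by
    rw [Set.disjoint_left]
    rintro ⟨x, y⟩ ⟨ha, hb⟩ (⟨-, hc⟩ | ⟨-, hc⟩) <;>
    simp only [planeDisc, Set.mem_ofPred_eq] at ha hb hc <;>
    nlinarith [sq_nonneg y, sq_nonneg (1 - x - y), sq_nonneg x]
  have e2 : volume.real (planeDisc r ∩ {p | p.2 < 0}) = volume.real (planeDisc r ∩ {p | p.1 < 0}) :=
    congrArg ENNReal.toReal (volume_planeDisc_inter_snd_neg r)
  have e3 : volume.real (planeDisc r ∩ {p | 1 - p.1 - p.2 < 0})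
      = volume.real (planeDisc r ∩ {p | p.2 < 0}) :=
    congrArg ENNReal.toReal (volume_planeDisc_inter_third_neg r)
  have e0 : volume.real (planeDisc r) = Real.sqrt 3 * Real.pi * r ^ 2 / 2 := by
    rw [measureReal_def, volume_planeDisc hr, ENNReal.toReal_ofReal (by positivity)]
  rw [hdiff, measureReal_union hd1 (h2.union h3) (hfin' _)
    (measure_union_ne_top (hfin' _) (hfin' _)),
    measureReal_union hd23 h3 (hfin' _) (hfin' _), e3, e2, e0] at hsplit
  linarith

theorem volume_planeDisc_inter_fst_neg {r : ℝ} (hr : 0 < r) (hr' : 1 / 3 ≤ r) :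
    volume.real (planeDisc r ∩ {p | p.1 < 0}) = Real.sqrt 3 *
      ((-(Real.sqrt (r ^ 2 - 1 / 9) / 3)
        + r ^ 2 * (Real.pi / 2 - Real.arcsin (1 / (3 * r)))) / 2) := by
  rw [measureReal_def, volume_planeDisc_inter hr (by linarith) (by linarith),
    -- The detour through the integral form supplies the nonnegativity that `ENNReal.toReal_ofReal`
    -- needs.
    ← integral_sqrt_sq_sub_sq hr (by linarith) (by linarith), ENNReal.toReal_ofReal,
    integral_sqrt_sq_sub_sq hr (by linarith) (by linarith)]
  · rw [show (0 - 1 / 3) / r = -(1 / (3 * r)) by field_simp; norm_num, Real.arcsin_neg]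
    norm_num
    ring
  · exact mul_nonneg (Real.sqrt_nonneg _) (intervalIntegral.integral_nonneg (by linarith)
      fun _ _ => Real.sqrt_nonneg _)

theorem volume_planeDisc_inter_fst_neg_eq_zero {r : ℝ} (hr : 0 < r) (hr' : r ≤ 1 / 3) :
    volume.real (planeDisc r ∩ {p | p.1 < 0}) = 0 := by
  rw [Set.eq_empty_of_forall_notMem (s := planeDisc r ∩ _), measureReal_empty]
  rintro ⟨x, y⟩ ⟨ha, hb⟩
  simp only [planeDisc, Set.mem_ofPred_eq] at ha hb
  nlinarith [sq_nonneg (y - (1 - x) / 2)]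

/-! ### Cones under the exponential law -/

theorem exponentialPDF_mul_mul {x y z : ℝ} :
    exponentialPDF 1 x * exponentialPDF 1 y * exponentialPDF 1 z =
      Set.indicator {q : ℝ × ℝ × ℝ | 0 ≤ q.1 ∧ 0 ≤ q.2.1 ∧ 0 ≤ q.2.2}
        (fun q => ENNReal.ofReal (Real.exp (-(q.1 + q.2.1 + q.2.2)))) (x, y, z) := by
  by_cases hx : 0 ≤ x
  swap
  · simp [exponentialPDF_of_neg (not_le.1 hx), hx]
  by_cases hy : 0 ≤ y
  swap
  · simp [exponentialPDF_of_neg (not_le.1 hy), hy]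
  by_cases hz : 0 ≤ z
  swap
  · simp [exponentialPDF_of_neg (not_le.1 hz), hz]
  rw [Set.indicator_of_mem (by exact ⟨hx, hy, hz⟩), exponentialPDF_of_nonneg hx,
    exponentialPDF_of_nonneg hy, exponentialPDF_of_nonneg hz, ← ENNReal.ofReal_mul (by positivity),
    ← ENNReal.ofReal_mul (by positivity)]
  simp only [one_mul, ← Real.exp_add]
  congr 2
  ring

/-- This is `Γ(3) = 2!`. -/
theorem lintegral_exp_neg_mul_sq :
    ∫⁻ s in Set.Ioi (0 : ℝ), ENNReal.ofReal (Real.exp (-s)) * ENNReal.ofReal (s ^ 2) = 2 := by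
  have h3 : (0 : ℝ) < 3 := by norm_num
  have hc : ∀ s : ℝ, Real.exp (-s) * s ^ ((3 : ℝ) - 1) = Real.exp (-s) * s ^ 2 := fun s => by
    norm_num
  have hi := Real.GammaIntegral_convergent h3
  have hg := Real.Gamma_eq_integral h3
  simp only [hc] at hi hg
  simp only [← ENNReal.ofReal_mul (Real.exp_pos _).le]
  rw [← ofReal_integral_eq_lintegral_ofReal hi (ae_of_all _ fun s => by positivity), ← hg,
    show (3 : ℝ) = (2 : ℕ) + 1 by norm_num, Real.Gamma_nat_eq_factorial]
  norm_num

open scoped Pointwise in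
/-- The measure of a cone under three independent exponential laws is twice the area of its slice
by the simplex. -/
theorem expMeasure_prod_prod_apply_cone {A : Set ((ℝ × ℝ) × ℝ)} (hA : MeasurableSet A)
    (hcone : ∀ s : ℝ, 0 < s → ∀ q, s • q ∈ A ↔ q ∈ A) :
    (((expMeasure 1).prod (expMeasure 1)).prod (expMeasure 1)) A
      = 2 * volume ((fun p : ℝ × ℝ => (p, 1 - p.1 - p.2)) ⁻¹' A ∩ planeSimplex) := by
  set K := (fun p : ℝ × ℝ => (p, 1 - p.1 - p.2)) ⁻¹' A ∩ planeSimplex with hK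
  have hKm : MeasurableSet K := (hA.preimage (by fun_prop)).inter measurableSet_planeSimplex
  have hf : Measurable (exponentialPDF 1) := (measurable_exponentialPDFReal 1).ennreal_ofReal
  have he : expMeasure 1 = (volume : Measure ℝ).withDensity (exponentialPDF 1) := rfl
  have : IsProbabilityMeasure (expMeasure 1) := isProbabilityMeasure_expMeasure one_pos
  have : SFinite ((volume : Measure ℝ).withDensity (exponentialPDF 1)) := he ▸ inferInstance
  set F : (ℝ × ℝ) × ℝ → ENNReal := A.indicator fun q =>
    exponentialPDF 1 q.1.1 * exponentialPDF 1 q.1.2 * exponentialPDF 1 q.2 with hF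
  have hFm : Measurable F := Measurable.indicator (by fun_prop) hA
  have hslice : ∀ s : ℝ, s ≠ 0 → ∫⁻ p : ℝ × ℝ, F (p, s - (p.1 + p.2))
      = (Set.Ioi (0 : ℝ)).indicator (fun s => ENNReal.ofReal (Real.exp (-s)) *
        ENNReal.ofReal (s ^ 2) * volume K) s := by
    intro s hs0
    rcases hs0.lt_or_gt with hs | hs
    · rw [Set.indicator_of_notMem (by simpa using hs.le)]
      refine (lintegral_congr fun p => ?_).trans lintegral_zero
      refine Set.indicator_apply_eq_zero.2 fun _ => ?_
      rw [exponentialPDF_mul_mul, Set.indicator_of_notMem]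
      rintro ⟨h1, h2, h3⟩
      simp only at h1 h2 h3
      linarith
    · rw [Set.indicator_of_mem (by exact hs)]
      -- By the cone property the plane of sum `s` meets `A` and the octant in `s • K`, and the
      -- density there is constant.
      have hpt : ∀ p : ℝ × ℝ, F (p, s - (p.1 + p.2))
          = (s • K).indicator (fun _ => ENNReal.ofReal (Real.exp (-s))) p := by
        rintro ⟨x, y⟩
        have hmem : (x, y) ∈ s • K ↔ ((x, y), s - (x + y)) ∈ A ∧ 0 ≤ x ∧ 0 ≤ y ∧
            0 ≤ s - (x + y) := by
          rw [Set.mem_smul_set_iff_inv_smul_mem₀ hs.ne', ← hcone s⁻¹ (inv_pos.2 hs)]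
          have e : 1 - s⁻¹ * x - s⁻¹ * y = s⁻¹ * (s - (x + y)) := by field_simp; ring
          simp only [hK, planeSimplex, Set.mem_inter_iff, Set.mem_preimage, Set.mem_ofPred_eq,
            Prod.smul_mk, smul_eq_mul, e, mul_nonneg_iff_of_pos_left (inv_pos.2 hs)]
        have hsum : x + y + (s - (x + y)) = s := by ring
        classical
        rw [hF, Set.indicator_apply, Set.indicator_apply, exponentialPDF_mul_mul,
          Set.indicator_apply, hsum]
        simp only [hmem, Set.mem_ofPred_eq]
        simp only [ite_and]
      rw [lintegral_congr hpt, lintegral_indicator_const (hKm.const_smul_of_ne_zero hs.ne'),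
        Measure.addHaar_smul, Module.finrank_prod, Module.finrank_self, abs_of_nonneg (by positivity),
        mul_assoc]
  calc (((expMeasure 1).prod (expMeasure 1)).prod (expMeasure 1)) A
      = ∫⁻ q, F q := by
        rw [he, prod_withDensity hf hf, prod_withDensity (by fun_prop) hf, withDensity_apply _ hA,
          ← lintegral_indicator hA]
        rfl
    _ = ∫⁻ p : ℝ × ℝ, ∫⁻ z : ℝ, F (p, z) := by
        rw [Measure.volume_eq_prod, lintegral_prod _ hFm.aemeasurable]
    _ = ∫⁻ p : ℝ × ℝ, ∫⁻ s : ℝ, F (p, s - (p.1 + p.2)) := by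
        -- Translation invariance lets the sum `s` replace `z` as variable.
        refine lintegral_congr fun p => ?_
        rw [lintegral_sub_right_eq_self (fun z => F (p, z)) (p.1 + p.2)]
    _ = ∫⁻ s : ℝ, ∫⁻ p : ℝ × ℝ, F (p, s - (p.1 + p.2)) :=
        lintegral_lintegral_swap (hFm.comp (by fun_prop)).aemeasurable
    _ = ∫⁻ s in Set.Ioi (0 : ℝ), ENNReal.ofReal (Real.exp (-s)) *
        ENNReal.ofReal (s ^ 2) * volume K := by
        rw [← lintegral_indicator measurableSet_Ioi]
        refine lintegral_congr_ae ?_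
        filter_upwards [Measure.ae_ne volume 0] with s hs using hslice s hs
    _ = 2 * volume K := by
        rw [lintegral_mul_const _ (by fun_prop), lintegral_exp_neg_mul_sq]

/-! ### The statistic on the simplex -/

theorem measurable_ratioStat {n : ℕ} : Measurable (ratioStat : (Fin n → ℝ) → ℝ) := by
  unfold ratioStat sampleSD sampleVar sampleMean
  fun_prop

theorem ratioStat_smul {n : ℕ} {s : ℝ} (hs : 0 < s) (x : Fin n → ℝ) :
    ratioStat (s • x) = ratioStat x := by
  have hm : sampleMean (s • x) = s * sampleMean x := by
    simp [sampleMean, ← Finset.mul_sum, mul_div_assoc]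
  have hv : sampleVar (s • x) = s ^ 2 * sampleVar x := by
    simp [sampleVar, hm, ← mul_sub, mul_pow, ← Finset.mul_sum, mul_div_assoc]
  rw [ratioStat, ratioStat, sampleSD, sampleSD, hm, hv, Real.sqrt_mul (by positivity),
    Real.sqrt_sq hs.le, mul_div_mul_left _ _ hs.ne']

theorem ratioStat_eq_sqrt_shapeEstimator {n : ℕ} {x : Fin n → ℝ} (hx : ∀ i, 0 ≤ x i) :
    ratioStat x = Real.sqrt (shapeEstimator x) := by
  have hm : 0 ≤ sampleMean x := div_nonneg (Finset.sum_nonneg fun i _ => hx i) n.cast_nonneg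
  rw [ratioStat, shapeEstimator, sampleSD, Real.sqrt_div (sq_nonneg _), Real.sqrt_sq hm]

/-- The centroid must be excluded: it lies in the disc, but its variance is zero and division by
zero makes the ratio `0`. -/
theorem lt_ratioStat_iff {t x y : ℝ} (ht : 0 < t) (hxy : (x, y) ≠ ((1 / 3, 1 / 3) : ℝ × ℝ)) :
    t < ratioStat ![x, y, 1 - x - y] ↔ (x, y) ∈ planeDisc (Real.sqrt 2 / (3 * t)) := by
  have hm : sampleMean ![x, y, 1 - x - y] = 1 / 3 := by
    simp [sampleMean, Fin.sum_univ_three]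
  have hv : sampleVar ![x, y, 1 - x - y]
      = (x ^ 2 + y ^ 2 + (1 - x - y) ^ 2 - 1 / 3) / 3 := by
    simp only [sampleVar, hm, Fin.sum_univ_three, Matrix.cons_val]
    push_cast
    ring
  have hpos : 0 < x ^ 2 + y ^ 2 + (1 - x - y) ^ 2 - 1 / 3 := by
    rw [show x ^ 2 + y ^ 2 + (1 - x - y) ^ 2 - 1 / 3
        = 3 / 2 * (x - 1 / 3) ^ 2 + 2 * (y - (1 - x) / 2) ^ 2 by ring]
    by_cases hx : x = 1 / 3
    · have hy : y - (1 - x) / 2 ≠ 0 := fun h => hxy (Prod.ext hx (by dsimp only; linarith))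
      have := sq_pos_of_ne_zero hy
      positivity
    · have := sq_pos_of_ne_zero (sub_ne_zero.2 hx)
      positivity
  rw [ratioStat, sampleSD, hm, hv, planeDisc, Set.mem_ofPred_eq, lt_div_iff₀ (by positivity),
    ← lt_div_iff₀' ht, Real.sqrt_lt' (by positivity), div_pow _ (3 * t), Real.sq_sqrt (by norm_num),
    div_lt_iff₀ (by norm_num),
    show (1 / 3 / t) ^ 2 * 3 = 3 / 2 * (2 / (3 * t) ^ 2) by field_simp]

theorem ae_nonneg_of_hasLaw_expMeasure {Ω : Type*} [MeasurableSpace Ω] {μ : Measure Ω}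
    {Y : Ω → ℝ} (hY : HasLaw Y (expMeasure 1) μ) :
    ∀ᵐ ω ∂μ, 0 ≤ Y ω := by
  refine ae_of_ae_map hY.aemeasurable ?_
  rw [hY.map_eq, ae_iff, show {a : ℝ | ¬0 ≤ a} = Set.Iio 0 by ext; simp]
  change (volume.withDensity (exponentialPDF 1)) _ = 0
  rw [withDensity_apply _ measurableSet_Iio, lintegral_exponentialPDF_of_nonpos le_rfl]

/-! ### The distribution function -/

section

variable {Ω : Type*} [MeasurableSpace Ω] {μ : Measure Ω} [IsProbabilityMeasure μ]
  {X : Fin 3 → Ω → ℝ}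

theorem map_eq_expMeasure_prod_prod (hindep : iIndepFun X μ)
    (hlaw : ∀ i, HasLaw (X i) (expMeasure 1) μ) :
    μ.map (fun ω => ((X 0 ω, X 1 ω), X 2 ω))
      = ((expMeasure 1).prod (expMeasure 1)).prod (expMeasure 1) := by
  have hm := fun i => (hlaw i).aemeasurable
  have h01 := (indepFun_iff_map_prod_eq_prod_map_map (hm 0) (hm 1)).1
    (hindep.indepFun (by decide))
  have h012 := (indepFun_iff_map_prod_eq_prod_map_map ((hm 0).prodMk (hm 1)) (hm 2)).1
    (hindep.indepFun_prodMk₀ hm 0 1 2 (by decide) (by decide))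
  rw [h012, h01, (hlaw 0).map_eq, (hlaw 1).map_eq, (hlaw 2).map_eq]

theorem cdf_map_ratioStat (hindep : iIndepFun X μ) (hlaw : ∀ i, HasLaw (X i) (expMeasure 1) μ)
    {t : ℝ} (ht : 0 < t) :
    cdf (μ.map (fun ω => ratioStat (fun i => X i ω))) t
      = 1 - 2 * volume.real (planeDisc (Real.sqrt 2 / (3 * t)) ∩ planeSimplex) := by
  have hm := fun i => (hlaw i).aemeasurable
  have hT : AEMeasurable (fun ω => ratioStat (fun i => X i ω)) μ :=
    measurable_ratioStat.comp_aemeasurable (aemeasurable_pi_lambda _ hm)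
  have := Measure.isProbabilityMeasure_map hT
  set g : (ℝ × ℝ) × ℝ → (Fin 3 → ℝ) := fun q => ![q.1.1, q.1.2, q.2] with hg
  have hgm : Measurable g := measurable_pi_lambda _ fun i => by
    fin_cases i <;> simp only [hg] <;> fun_prop
  set A : Set ((ℝ × ℝ) × ℝ) := {q | t < ratioStat (g q)} with hA
  have hAm : MeasurableSet A := measurableSet_lt measurable_const (measurable_ratioStat.comp hgm)
  have hcone : ∀ s : ℝ, 0 < s → ∀ q, s • q ∈ A ↔ q ∈ A := by
    intro s hs q
    have : g (s • q) = s • g q := by simp [hg]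
    simp only [hA, Set.mem_ofPred_eq, this, ratioStat_smul hs]
  have hslice : volume ((fun p : ℝ × ℝ => (p, 1 - p.1 - p.2)) ⁻¹' A ∩ planeSimplex)
      = volume (planeDisc (Real.sqrt 2 / (3 * t)) ∩ planeSimplex) := by
    refine measure_congr (Filter.EventuallyEq.inter ?_ (ae_eq_refl _))
    filter_upwards [Measure.ae_ne volume ((1 / 3, 1 / 3) : ℝ × ℝ)] with p hp
    exact propext (lt_ratioStat_iff ht hp)
  have hprob : μ.map (fun ω => ratioStat (fun i => X i ω)) (Set.Ioi t)
      = 2 * volume (planeDisc (Real.sqrt 2 / (3 * t)) ∩ planeSimplex) := by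
    rw [← hslice, ← expMeasure_prod_prod_apply_cone hAm hcone,
      ← map_eq_expMeasure_prod_prod hindep hlaw,
      Measure.map_apply_of_aemeasurable (((hm 0).prodMk (hm 1)).prodMk (hm 2)) hAm,
      Measure.map_apply_of_aemeasurable hT measurableSet_Ioi]
    rfl
  rw [cdf_eq_real, ← Set.compl_Ioi, probReal_compl_eq_one_sub measurableSet_Ioi,
    measureReal_def, hprob, ENNReal.toReal_mul, measureReal_def, ENNReal.toReal_ofNat]

theorem cdf_map_ratioStat_of_sqrt_two_le (hindep : iIndepFun X μ)
    (hlaw : ∀ i, HasLaw (X i) (expMeasure 1) μ) {t : ℝ} (ht : Real.sqrt 2 ≤ t) :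
    cdf (μ.map (fun ω => ratioStat (fun i => X i ω))) t
      = 1 - 2 * Real.pi / (3 * Real.sqrt 3 * t ^ 2) := by
  have h2 : 0 < Real.sqrt 2 := by positivity
  have h0 : 0 < t := h2.trans_le ht
  have hr : Real.sqrt 2 / (3 * t) ≤ 1 / 3 := by
    rw [div_le_div_iff₀ (by positivity) (by positivity)]
    linarith
  rw [cdf_map_ratioStat hindep hlaw h0, volume_planeDisc_inter_planeSimplex (by positivity)
    (by linarith), volume_planeDisc_inter_fst_neg_eq_zero (by positivity) hr, div_pow,
    Real.sq_sqrt (by norm_num)]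
  have h3 : Real.sqrt 3 ^ 2 = 3 := Real.sq_sqrt (by norm_num)
  field_simp
  linear_combination (-2 * Real.pi) * h3

theorem cdf_map_ratioStat_of_le_sqrt_two (hindep : iIndepFun X μ)
    (hlaw : ∀ i, HasLaw (X i) (expMeasure 1) μ) {t : ℝ} (ht : Real.sqrt 2 / 2 ≤ t)
    (ht' : t ≤ Real.sqrt 2) :
    cdf (μ.map (fun ω => ratioStat (fun i => X i ω))) t
      = -(Real.sqrt (2 - t ^ 2) / (Real.sqrt 3 * t)) + Real.pi / (3 * Real.sqrt 3 * t ^ 2)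
          - 2 * Real.arcsin (t / Real.sqrt 2) / (Real.sqrt 3 * t ^ 2) + 1 := by
  have h2 : 0 < Real.sqrt 2 := by positivity
  have h0 : 0 < t := by linarith
  have hr : Real.sqrt 2 / (3 * t) ≤ 2 / 3 := by
    rw [div_le_div_iff₀ (by positivity) (by positivity)]
    linarith
  have hr' : 1 / 3 ≤ Real.sqrt 2 / (3 * t) := by
    rw [div_le_div_iff₀ (by positivity) (by positivity)]
    linarith
  have hsq2 : Real.sqrt 2 ^ 2 = 2 := Real.sq_sqrt (by norm_num)
  have hsq3 : Real.sqrt 3 ^ 2 = 3 := Real.sq_sqrt (by norm_num)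
  have hs : Real.sqrt ((Real.sqrt 2 / (3 * t)) ^ 2 - 1 / 9) = Real.sqrt (2 - t ^ 2) / (3 * t) := by
    rw [div_pow, hsq2, show 2 / (3 * t) ^ 2 - 1 / 9 = (2 - t ^ 2) / (3 * t) ^ 2 by
      field_simp; ring, Real.sqrt_div' _ (by positivity), Real.sqrt_sq (by positivity)]
  have ha : 1 / (3 * (Real.sqrt 2 / (3 * t))) = t / Real.sqrt 2 := by field_simp
  rw [cdf_map_ratioStat hindep hlaw h0, volume_planeDisc_inter_planeSimplex (by positivity)
    (by linarith), volume_planeDisc_inter_fst_neg (by positivity) hr', hs, ha, div_pow, hsq2]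
  field_simp
  linear_combination (Real.pi - 3 * t * Real.sqrt (2 - t ^ 2)
    - 6 * Real.arcsin (t / Real.sqrt 2)) * hsq3

theorem cdf_map_ratioStat_of_lt (hindep : iIndepFun X μ)
    (hlaw : ∀ i, HasLaw (X i) (expMeasure 1) μ) {t : ℝ} (ht : t < Real.sqrt 2 / 2) :
    cdf (μ.map (fun ω => ratioStat (fun i => X i ω))) t = 0 := by
  have h2 : 0 < Real.sqrt 2 := by positivity
  have hsq2 : Real.sqrt 2 ^ 2 = 2 := Real.sq_sqrt (by norm_num)
  have hsq3 : Real.sqrt 3 ^ 2 = 3 := Real.sq_sqrt (by norm_num)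
  -- The middle formula vanishes at its left endpoint, where `arcsin (1 / 2) = π / 6`; monotonicity
  -- of the cdf handles smaller `t`, including `t ≤ 0`.
  have hend : cdf (μ.map (fun ω => ratioStat (fun i => X i ω))) (Real.sqrt 2 / 2) = 0 := by
    have ha : Real.arcsin (Real.sqrt 2 / 2 / Real.sqrt 2) = Real.pi / 6 := by
      rw [show Real.sqrt 2 / 2 / Real.sqrt 2 = 1 / 2 by field_simp, ← Real.sin_pi_div_six,
        Real.arcsin_sin] <;> linarith [Real.pi_pos]
    have hs : Real.sqrt (2 - (Real.sqrt 2 / 2) ^ 2) = Real.sqrt 3 * (Real.sqrt 2 / 2) := by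
      rw [Real.sqrt_eq_iff_mul_self_eq (by rw [div_pow, hsq2]; norm_num) (by positivity)]
      linear_combination -(Real.sqrt 3 ^ 2 / 4 + 1 / 4) * hsq2 - hsq3 / 2
    rw [cdf_map_ratioStat_of_le_sqrt_two hindep hlaw le_rfl (by linarith), ha, hs]
    field_simp
    ring
  exact le_antisymm ((monotone_cdf _ ht.le).trans_eq hend) (cdf_nonneg _ _)

end

theorem proposition1 {Ω : Type*} [MeasurableSpace Ω] (μ : Measure Ω) [IsProbabilityMeasure μ]
    (X : Fin 3 → Ω → ℝ) (hindep : iIndepFun X μ)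
    (hlaw : ∀ i, HasLaw (X i) (expMeasure 1) μ) :
    (∀ᵐ ω ∂μ, ratioStat (fun i => X i ω) = Real.sqrt (shapeEstimator (fun i => X i ω))) ∧
    (∀ t : ℝ, Real.sqrt 2 ≤ t →
      cdf (μ.map (fun ω => ratioStat (fun i => X i ω))) t
        = 1 - 2 * Real.pi / (3 * Real.sqrt 3 * t ^ 2)) ∧
    (∀ t : ℝ, Real.sqrt 2 / 2 ≤ t → t ≤ Real.sqrt 2 →
      cdf (μ.map (fun ω => ratioStat (fun i => X i ω))) t
        = -(Real.sqrt (2 - t ^ 2) / (Real.sqrt 3 * t)) + Real.pi / (3 * Real.sqrt 3 * t ^ 2)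
          - 2 * Real.arcsin (t / Real.sqrt 2) / (Real.sqrt 3 * t ^ 2) + 1) ∧
    (∀ t : ℝ, t < Real.sqrt 2 / 2 →
      cdf (μ.map (fun ω => ratioStat (fun i => X i ω))) t = 0) := by
  refine ⟨?_, fun t ht => cdf_map_ratioStat_of_sqrt_two_le hindep hlaw ht,
    fun t ht ht' => cdf_map_ratioStat_of_le_sqrt_two hindep hlaw ht ht',
    fun t ht => cdf_map_ratioStat_of_lt hindep hlaw ht⟩
  filter_upwards [ae_all_iff.2 fun i => ae_nonneg_of_hasLaw_expMeasure (hlaw i)] with ω hω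
  exact ratioStat_eq_sqrt_shapeEstimator hω
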